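/- A variety over a field $k$ is an integral scheme that is separated and of finite type over $k$; $K(X)$ denotes the function field of an integral scheme $X$. Let $k$ be a field of characteristic $p>0$ and let $X$ be a variety over $k$ such that $k$ is algebraically closed in $K(X)$. An elemental extension $(k\subset l\subset k',\ \varphi:X'\to X)$ of $(k,X)$ consists of field extensions $k\subset l\subset k'$ and a morphism of schemes $\varphi:X'\to X$ such that: $k\subset l$ is purely inseparable with $l^p\subset k$, and $X\times_k l$ is an integral scheme; $X'$ is equipped with a morphism $X'\to X\times_k l$ which is the normalisation of $X\times_k l$; $\varphi$ is the composite $X'\to X\times_k l\to X$; and $k'$ is the algebraic closure of $l$ in $K(X')$. Its internal degree is $[l:k]$ (possibly infinite) and its external degree is $[k':l]$. Proposition. Let $k_Y$ be a field of characteristic $p>0$ and let $f:X\to Y$ be a smooth $k_Y$-morphism of normal varieties over $k_Y$ such that $k_Y$ is algebraically closed in $K(Y)$. Let $k_X$ be the algebraic closure of $k_Y$ in $K(X)$ (so that $X$ is naturally a scheme over $k_X$). Let $(k_Y\subset l_Y\subset k'_Y,\ \psi:Y'\to Y)$ be an elemental extension of $(k_Y,Y)$. Set $l_X:=l_Y\otimes_{k_Y}k_X$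 and $X':=Y'\times_Y X$. Then the following hold. (1) $l_X$ and $k'_Y\otimes_{k_Y}k_X$ are fields. (2) $X\times_{k_X}l_X$ is an integral scheme, and the induced morphism $X'\to X\times_{k_X}l_X$ is the normalisation of $X\times_{k_X}l_X$. (3) $(k_X\subset l_X\subset k'_X,\ \varphi:X'\to X)$ is an elemental extension of $(k_X,X)$, where $\varphi$ is the projection and $k'_X$ is the algebraic closure of $l_X$ in $K(X')$. (4) $[l_X:k_X]=[l_Y:k_Y]$ and $[k'_X:l_X]\ge[k'_Y:l_Y]$. (5) If $Y\times_{k_Y}l_Y$ is normal, then $X\times_{k_X}l_X$ is normal. (6) If $f$ is surjective and $X\times_{k_X}l_X$ is normal, then $Y\times_{k_Y}l_Y$ is normal. -/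

import Mathlib

open AlgebraicGeometry CategoryTheory CategoryTheory.Limits
open scoped TensorProduct

universe u

namespace Elemental

noncomputable section

/-- The morphism `Spec S ⟶ Spec R` attached to an `R`-algebra `S`. -/
abbrev specMap (R S : Type u) [CommRing R] [CommRing S] [Algebra R S] :
    Spec (CommRingCat.of S) ⟶ Spec (CommRingCat.of R) :=
  Spec.map (CommRingCat.ofHom (algebraMap R S))

/-- A scheme is normal if all its local rings are integrally closed domains. -/
def IsNormal (X : Scheme.{u}) : Prop :=
  ∀ x : X, IsDomain (X.presheaf.stalk x) ∧ IsIntegrallyClosed (X.presheaf.stalk x)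

/-- A variety over `k`: an integral scheme that is separated and of finite type over `k`. -/
structure IsVariety {k : Type u} [CommRing k] {X : Scheme.{u}}
    (s : X ⟶ Spec (CommRingCat.of k)) : Prop where
  isIntegral : IsIntegral X
  isSeparated : IsSeparated s
  locallyOfFiniteType : LocallyOfFiniteType s
  quasiCompact : QuasiCompact s

/-- The ring homomorphism `k → Γ(X, 𝒪_X) → K(X)` given by a structure morphism `X ⟶ Spec k`. -/
def toFunctionField {k : Type u} [CommRing k] {X : Scheme.{u}} [IsIntegral X]
    (s : X ⟶ Spec (CommRingCat.of k)) : k →+* X.functionField :=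
  ((Scheme.ΓSpecIso (CommRingCat.of k)).inv ≫ s.appTop ≫ X.presheaf.germ ⊤ (genericPoint X) trivial).hom

section Closure

variable {R K : Type u} [CommRing R] [CommRing K]

/-- The set of elements of `K` that are integral over `R` along `g : R →+* K`. When `R` and `K` are
fields, this is the algebraic closure of `R` in `K`. -/
def closureIn (g : R →+* K) : Subring K :=
  letI := g.toAlgebra
  (integralClosure R K).toSubring

theorem mem_closureIn (g : R →+* K) (x : K) : x ∈ closureIn g ↔ g.IsIntegralElem x :=
  Iff.rfl

instance closureInAlgebra (g : R →+* K) : Algebra R (closureIn g) :=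
  (g.codRestrict (closureIn g) fun x =>
    (mem_closureIn g (g x)).2 (g.isIntegralElem_map)).toAlgebra

end Closure

/-- The inclusion `Spec K(Z) ⟶ Z` of the generic point of an integral scheme. -/
abbrev genericInclusion (Z : Scheme.{u}) [IsIntegral Z] : Spec Z.functionField ⟶ Z :=
  Z.fromSpecStalk (genericPoint Z)

instance genericInclusion_quasiCompact (Z : Scheme.{u}) [IsIntegral Z] :
    QuasiCompact (genericInclusion Z) := by
  refine ⟨fun U _ _ => ?_⟩
  have : Subsingleton (Spec Z.functionField) :=
    inferInstanceAs (Subsingleton (PrimeSpectrum Z.functionField))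
  exact (Set.toFinite _).isCompact

/-- `ν : Z' ⟶ Z` is the normalisation of the integral scheme `Z`: up to an isomorphism over `Z`, it
is the relative normalisation of `Z` in its generic point (locally, the spectrum of the integral
closure of the ring in its fraction field). -/
def IsNormalization {Z' Z : Scheme.{u}} [IsIntegral Z] (ν : Z' ⟶ Z) : Prop :=
  ∃ e : Z' ≅ (genericInclusion Z).normalization,
    e.hom ≫ (genericInclusion Z).fromNormalization = ν

/-- `(k ⊆ l ⊆ k', φ : X' ⟶ X)` is an elemental extension of `(k, X)`, where `s : X ⟶ Spec k` is the
structure morphism. The morphism `ν` is the induced one `X' ⟶ X ×ₖ l`, and `ι` is the inclusion of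
`k'` in `K(X')`. -/
structure IsElementalExtension (p : ℕ) {k l k' : Type u} [CommRing k] [CommRing l] [CommRing k']
    [Algebra k l] [Algebra l k'] {X X' : Scheme.{u}} [IsIntegral X] [IsIntegral X']
    (s : X ⟶ Spec (CommRingCat.of k)) (φ : X' ⟶ X) (ν : X' ⟶ pullback s (specMap k l))
    (ι : k' →+* X'.functionField) : Prop where
  /-- The base: `k` is a field of characteristic `p > 0`, and `X` is a variety over `k` such that
  `k` is algebraically closed in `K(X)`. -/
  isField_base : IsField k
  prime : p.Prime
  charP : CharP k p
  isVariety : IsVariety s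
  algClosed : closureIn (toFunctionField s) = (toFunctionField s).range
  /-- `l` and `k'` are fields. -/
  isField_int : IsField l
  isField_top : IsField k'
  /-- `k ⊆ l` is purely inseparable with `l ^ p ⊆ k`, and `X ×ₖ l` is integral. -/
  isPurelyInseparable : IsPurelyInseparable k l
  pow_mem : ∀ x : l, x ^ p ∈ (algebraMap k l).range
  isIntegral_baseChange : IsIntegral (pullback s (specMap k l))
  /-- `X' ⟶ X ×ₖ l` is the normalisation of `X ×ₖ l`. -/
  isNormalization : IsNormalization ν
  /-- `φ` is the induced morphism. -/
  comp_fst : ν ≫ pullback.fst s (specMap k l) = φ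
  /-- `k'` is the algebraic closure of `l` in `K(X')`. -/
  comp_algebraMap :
    ι.comp (algebraMap l k') = toFunctionField (ν ≫ pullback.snd s (specMap k l))
  range_eq : ι.range = closureIn (toFunctionField (ν ≫ pullback.snd s (specMap k l)))

/-- The algebraic closure of `k` in `K(X)`, for a structure morphism `s : X ⟶ Spec k`. -/
abbrev closureInFunctionField {k : Type u} [CommRing k] {X : Scheme.{u}} [IsIntegral X]
    (s : X ⟶ Spec (CommRingCat.of k)) : Subring X.functionField :=
  closureIn (toFunctionField s)

end

end Elemental

/-!
The normalisation of an integral scheme is the factorisation of its generic point into a morphism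
that lifts uniquely against integral morphisms, followed by an integral one. Smooth base change
preserves it: relative normalisation commutes with smooth base change, and the generic fibre, being
smooth over a field, is normal. Hence `Y' ×_Y X` is the normalisation of
`(Y ×_{k_Y} l_Y) ×_Y X = X ×_{k_X} l_X`. That scheme is integral: it is reduced, being smooth over
`Y ×_{k_Y} l_Y`, and homeomorphic to `X`, since `k_Y ⊆ l_Y` is purely inseparable. Normality
descends along `X ×_{k_X} l_X ⟶ Y ×_{k_Y} l_Y` when `f` is surjective, since being an isomorphism
can be checked after a faithfully flat base change.

The two tensor products are fields because one factor is separable and the other purely inseparable.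
Indeed a smooth morphism is locally étale over an affine space, so `K(X)` is separable over a purely
transcendental extension of `K(Y)`, in which `k_Y` is still algebraically closed; hence `k_X` is
separable over `k_Y`. On the other side `K(Y ×_{k_Y} l_Y) = K(Y')` is purely inseparable over
`K(Y)`, hence so is `k'_Y` over `k_Y`. Finally `k'_Y ⊗_{k_Y} k_X = k'_Y ⊗_{l_Y} l_X`
embeds into `k'_X`, which bounds the external degree.
-/

namespace Elemental

section IntegrallyClosed

theorem isIntegrallyClosedIn_of_injective {k A B : Type*} [CommRing k] [CommRing A] [CommRing B]
    [Algebra k A] [Algebra k B] [IsIntegrallyClosedIn k B] {φ : A →ₐ[k] B}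
    (hφ : Function.Injective φ) : IsIntegrallyClosedIn k A := by
  refine isIntegrallyClosedIn_iff.mpr ⟨fun a b hab => ?_, fun {x} hx => ?_⟩
  · refine IsIntegralClosure.algebraMap_injective k k B ?_
    rw [← φ.commutes, ← φ.commutes, hab]
  · obtain ⟨c, hc⟩ := IsIntegrallyClosedIn.algebraMap_eq_of_integral (hx.map φ)
    exact ⟨c, hφ ((φ.commutes c).trans hc)⟩

open Polynomial in
theorem isIntegrallyClosedIn_polynomial (A : Type*) [CommRing A] [IsDomain A] :
    IsIntegrallyClosedIn A A[X] := by
  refine isIntegrallyClosedIn_iff.mpr ⟨C_injective, fun {f} hf => ?_⟩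
  by_contra hconst
  have hdeg : f.natDegree ≠ 0 := fun h => hconst (natDegree_eq_zero.mp h)
  have hlead : f.leadingCoeff ≠ 0 := leadingCoeff_ne_zero.mpr fun h => hdeg (by simp [h])
  exact transcendental f hdeg (mem_nonZeroDivisors_of_ne_zero hlead) hf.isAlgebraic

theorem isIntegrallyClosedIn_mvPolynomial (A : Type*) [CommRing A] [IsDomain A] (n : ℕ) :
    IsIntegrallyClosedIn A (MvPolynomial (Fin n) A) := by
  induction n with
  | zero => exact (MvPolynomial.isEmptyAlgEquiv A (Fin 0)).isIntegrallyClosedIn.mpr inferInstance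
  | succ n ih =>
    have := isIntegrallyClosedIn_polynomial (MvPolynomial (Fin n) A)
    exact (MvPolynomial.finSuccEquiv A n).isIntegrallyClosedIn.mpr <|
      .of_isIntegralClosure_of_isIntegrallyClosedIn A A (MvPolynomial (Fin n) A) _

theorem isIntegrallyClosed_mvPolynomial (A : Type*) [CommRing A] [IsDomain A]
    [IsIntegrallyClosed A] (n : ℕ) : IsIntegrallyClosed (MvPolynomial (Fin n) A) := by
  induction n with
  | zero => exact .of_equiv (MvPolynomial.isEmptyAlgEquiv A (Fin 0)).symm.toRingEquiv
  | succ n _ => exact .of_equiv (MvPolynomial.finSuccEquiv A n).symm.toRingEquiv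

open Polynomial in
theorem isSeparable_of_isIntegrallyClosedIn {k F L : Type*} [Field k] [Field F] [Field L]
    [Algebra k F] [Algebra F L] [Algebra k L] [IsScalarTower k F L] [IsIntegrallyClosedIn k F]
    {x : L} (hx : IsIntegral k x) (hs : IsSeparable F x) : IsSeparable k x := by
  have hcoeff (i : ℕ) : IsIntegral k ((minpoly F x).coeff i) :=
    isIntegral_coeff_of_dvd (minpoly k x) (minpoly F x) (minpoly.monic hx)
      (minpoly.monic hx.tower_top) (minpoly.dvd_map_of_isScalarTower k F x) i
  obtain ⟨q, hq⟩ : minpoly F x ∈ lifts (algebraMap k F) :=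
    (lifts_iff_coeff_lifts _).mpr fun i =>
      IsIntegrallyClosedIn.algebraMap_eq_of_integral (hcoeff i)
  replace hq : q.map (algebraMap k F) = minpoly F x := hq
  have hsep : q.Separable := by rwa [← separable_map (algebraMap k F), hq]
  have hroot : aeval x q = 0 := by rw [← aeval_map_algebraMap F, hq, minpoly.aeval]
  exact hsep.of_dvd (minpoly.dvd k x hroot)

theorem isPurelyInseparable_of_isIntegrallyClosedIn {k F K E : Type*} [Field k] [Field F]
    [Field K] [Field E] [Algebra k F] [Algebra F K] [Algebra k K] [IsScalarTower k F K]
    [Algebra k E] [IsPurelyInseparable F K] [IsIntegrallyClosedIn k F] [Algebra.IsAlgebraic k E]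
    (σ : E →ₐ[k] K) : IsPurelyInseparable k E := by
  refine (isPurelyInseparable_iff_pow_mem k (ringExpChar k)).mpr fun x => ?_
  have : ExpChar F (ringExpChar k) := expChar_of_injective_algebraMap (algebraMap k F).injective _
  obtain ⟨n, y, hy⟩ := IsPurelyInseparable.pow_mem F (ringExpChar k) (σ x)
  have hint : IsIntegral k (algebraMap F K y) := by
    rw [hy]
    exact ((Algebra.IsIntegral.isIntegral x).map σ).pow _
  obtain ⟨c, rfl⟩ := IsIntegrallyClosedIn.algebraMap_eq_of_integral
    ((isIntegral_algHom_iff (IsScalarTower.toAlgHom k F K) (algebraMap F K).injective).mp hint)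
  refine ⟨n, c, RingHom.injective (σ : E →+* K) ?_⟩
  change σ (algebraMap k E c) = σ (x ^ _)
  rw [σ.commutes, map_pow, ← hy, ← IsScalarTower.algebraMap_apply]

end IntegrallyClosed

section Etale

theorem isReduced_of_etale (P B : Type*) [CommRing P] [IsDomain P] [CommRing B] [Algebra P B]
    [Algebra.Etale P B] : IsReduced B := by
  let K := FractionRing P
  have : IsReduced (K ⊗[P] B) := Algebra.FormallyUnramified.isReduced_of_field K (K ⊗[P] B)
  exact isReduced_of_injective (Algebra.TensorProduct.includeRight : B →ₐ[P] K ⊗[P] B)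
    (Algebra.TensorProduct.includeRight_injective (IsFractionRing.injective P K))

theorem isIntegrallyClosedIn_tensorProduct_of_smooth (R S B : Type*) [CommRing R] [CommRing S]
    [CommRing B] [Algebra R S] [Algebra R B] [Algebra.Smooth R S] [IsIntegrallyClosedIn R B] :
    IsIntegrallyClosedIn S (S ⊗[R] B) := by
  have hinj : Function.Injective (algebraMap R B) := IsIntegralClosure.algebraMap_injective R R B
  refine isIntegrallyClosedIn_iff.mpr
    ⟨Algebra.TensorProduct.includeLeft_injective (S := R) hinj, fun {x} hx => ?_⟩
  obtain ⟨y, hy⟩ := (TensorProduct.toIntegralClosure_bijective_of_smooth (R := R) (S := S)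
    (B := B)).2 ⟨x, hx⟩
  have hsurj : Function.Surjective (algebraMap R (integralClosure R B)) := fun b => by
    obtain ⟨r, hr⟩ := IsIntegrallyClosedIn.algebraMap_eq_of_integral b.2
    exact ⟨r, Subtype.ext hr⟩
  obtain ⟨s, rfl⟩ := Algebra.TensorProduct.includeLeft_surjective (S := S) (A := S) hsurj y
  exact ⟨s, congrArg Subtype.val hy⟩

theorem isFractionRing_tensorProduct_of_etale (P K B : Type*) [CommRing P] [Field K]
    [Algebra P K] [IsFractionRing P K] [CommRing B] [IsDomain B] [Algebra P B]
    [Algebra.Etale P B] : IsFractionRing B (B ⊗[P] K) := by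
  have : IsDomain P := (IsFractionRing.injective P K).isDomain
  have hinj : Function.Injective (algebraMap P B) := FaithfulSMul.algebraMap_injective P B
  have hle : Algebra.algebraMapSubmonoid B (nonZeroDivisors P) ≤ nonZeroDivisors B := by
    rintro _ ⟨a, ha, rfl⟩
    exact mem_nonZeroDivisors_of_ne_zero
      ((map_ne_zero_iff _ hinj).mpr (nonZeroDivisors.ne_zero ha))
  have : IsLocalization (Algebra.algebraMapSubmonoid B (nonZeroDivisors P)) (B ⊗[P] K) :=
    IsLocalization.tensor K (nonZeroDivisors P)
  have : IsDomain (B ⊗[P] K) := IsLocalization.isDomain_of_le_nonZeroDivisors _ hle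
  let e := (Algebra.TensorProduct.comm P K B).toRingEquiv.toMulEquiv
  have : IsDomain (K ⊗[P] B) := e.isDomain _
  have : Module.Finite K (K ⊗[P] B) := Algebra.FormallyUnramified.finite_of_free K (K ⊗[P] B)
  have hfield : IsField (B ⊗[P] K) :=
    e.symm.isField (isField_of_isIntegral_of_isField' (R := K) (Field.toIsField K))
  let := hfield.toField
  refine IsLocalization.of_le _ _ hle fun b hb => Ne.isUnit ?_
  exact (map_ne_zero_iff _ (IsLocalization.injective _ hle)).mpr (nonZeroDivisors.ne_zero hb)

theorem isIntegrallyClosed_of_etale (P B : Type*) [CommRing P] [IsDomain P] [IsIntegrallyClosed P]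
    [CommRing B] [IsDomain B] [Algebra P B] [Algebra.Etale P B] : IsIntegrallyClosed B := by
  have := isFractionRing_tensorProduct_of_etale P (FractionRing P) B
  exact (isIntegrallyClosed_iff_isIntegrallyClosedIn (B ⊗[P] FractionRing P)).mpr
    (isIntegrallyClosedIn_tensorProduct_of_smooth P B (FractionRing P))

theorem isSeparable_fractionRing_of_etale (P B F L : Type*) [CommRing P] [CommRing B]
    [Field F] [Field L] [Algebra P B] [Algebra P F] [Algebra B L] [Algebra F L] [Algebra P L]
    [IsScalarTower P B L] [IsScalarTower P F L] [IsFractionRing B L] [Algebra.Etale P B] :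
    Algebra.IsSeparable F L := by
  have : Algebra.FormallyEtale B L := .of_isLocalization (nonZeroDivisors B)
  have : Algebra.FormallyEtale P L := .comp P B L
  have : Algebra.FormallyUnramified F L := .of_restrictScalars P F L
  have : Algebra.EssFiniteType B L := .of_isLocalization _ (nonZeroDivisors B)
  have : Algebra.EssFiniteType P L := .comp P B L
  have : Algebra.EssFiniteType F L := .of_comp P F L
  exact Algebra.FormallyUnramified.isSeparable F L

theorem isReduced_of_isStandardSmooth {A B : Type*} [CommRing A] [IsDomain A] [CommRing B]
    {f : A →+* B} (hf : f.IsStandardSmooth) : IsReduced B := by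
  obtain ⟨n, g, -, hg⟩ := hf.exists_etale_mvPolynomial
  algebraize [g]
  exact isReduced_of_etale (MvPolynomial (Fin n) A) B

theorem isIntegrallyClosed_of_isStandardSmooth {A B : Type*} [CommRing A] [IsDomain A]
    [IsIntegrallyClosed A] [CommRing B] [IsDomain B] {f : A →+* B} (hf : f.IsStandardSmooth) :
    IsIntegrallyClosed B := by
  obtain ⟨n, g, -, hg⟩ := hf.exists_etale_mvPolynomial
  algebraize [g]
  have := isIntegrallyClosed_mvPolynomial A n
  exact isIntegrallyClosed_of_etale (MvPolynomial (Fin n) A) B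

-- `Spec B` is étale over an affine space over `A`, whose function field is regular over that of
-- `A`, so only separable algebraic elements can be new in `L = Frac B`.
theorem isSeparable_of_isStandardSmooth {k A B L : Type*} [Field k] [CommRing A] [IsDomain A]
    [IsIntegrallyClosed A] [CommRing B] [Field L] [Algebra k A] [Algebra A B]
    [Algebra B L] [IsFractionRing B L] [Algebra k L] [IsIntegrallyClosedIn k A]
    (hcomp : (algebraMap B L).comp ((algebraMap A B).comp (algebraMap k A)) = algebraMap k L)
    (hs : (algebraMap A B).IsStandardSmooth) {x : L} (hx : IsIntegral k x) : IsSeparable k x := by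
  obtain ⟨n, g, hg, hge⟩ := hs.exists_etale_mvPolynomial
  algebraize [g]
  let P := MvPolynomial (Fin n) A
  let F := FractionRing P
  have : IsDomain B := (IsFractionRing.injective B L).isDomain
  have : IsIntegrallyClosed P := isIntegrallyClosed_mvPolynomial A n
  have : IsIntegrallyClosedIn A P := isIntegrallyClosedIn_mvPolynomial A n
  have : IsIntegrallyClosedIn k P := .of_isIntegralClosure_of_isIntegrallyClosedIn k k A P
  have : IsIntegrallyClosedIn k F := .of_isIntegralClosure_of_isIntegrallyClosedIn k k P F
  let : Algebra P L := ((algebraMap B L).comp g).toAlgebra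
  have : IsScalarTower P B L := .of_algebraMap_eq' rfl
  have : FaithfulSMul P L := (faithfulSMul_iff_algebraMap_injective P L).mpr <|
    (IsFractionRing.injective B L).comp (FaithfulSMul.algebraMap_injective P B)
  let : Algebra F L := FractionRing.liftAlgebra P L
  have : IsScalarTower P F L := FractionRing.isScalarTower_liftAlgebra P L
  have : IsScalarTower k F L := .of_algebraMap_eq' <| by
    rw [IsScalarTower.algebraMap_eq k P F, ← RingHom.comp_assoc,
      ← IsScalarTower.algebraMap_eq P F L, ← hcomp, ← hg]
    rfl
  have : Algebra.IsSeparable F L := isSeparable_fractionRing_of_etale P B F L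
  exact isSeparable_of_isIntegrallyClosedIn hx (Algebra.IsSeparable.isSeparable F x)

end Etale

section TensorProduct

variable {k E M : Type*} [Field k] [CommRing E] [CommRing M] [Algebra k E] [Algebra k M]

theorem pow_mem_range_tensorProduct {p : ℕ} [Fact p.Prime] [CharP k p]
    (hM : ∀ m : M, m ^ p ∈ (algebraMap k M).range) (z : E ⊗[k] M) :
    z ^ p ∈ (algebraMap E (E ⊗[k] M)).range := by
  nontriviality E ⊗[k] M
  have : CharP (E ⊗[k] M) p := charP_of_injective_algebraMap (algebraMap k (E ⊗[k] M)).injective p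
  induction z with
  | zero => exact ⟨0, by simp [(Fact.out : p.Prime).ne_zero]⟩
  | add x y hx hy =>
    rw [add_pow_char]
    exact add_mem hx hy
  | tmul a m =>
    obtain ⟨c, hc⟩ := hM m
    refine ⟨c • a ^ p, ?_⟩
    rw [Algebra.TensorProduct.tmul_pow, ← hc, Algebra.TensorProduct.algebraMap_apply,
      Algebra.algebraMap_self, RingHom.id_apply, TensorProduct.smul_tmul, Algebra.smul_def, mul_one]

end TensorProduct

section TensorProductField

variable {k E M : Type*} [Field k] [Field E] [Field M] [Algebra k E] [Algebra k M]

theorem isReduced_tensorProduct_of_isSeparable [Algebra.IsSeparable k E] :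
    IsReduced (M ⊗[k] E) := by
  refine IsReduced.tensorProduct_of_flat_of_forall_fg fun S hS => ?_
  have : Algebra.IsIntegral k S := .of_injective S.val Subtype.val_injective
  let : Field S := (isField_of_isIntegral_of_isField' (R := k) (Field.toIsField k)).toField
  have : Algebra.IsSeparable k S := .of_algHom k E S.val
  have : Algebra.FormallyUnramified k S := .of_isSeparable k S
  have : Algebra.FiniteType k S := S.fg_iff_finiteType.mp hS
  exact Algebra.FormallyUnramified.isReduced_of_field M (M ⊗[k] S)

theorem isField_tensorProduct [Algebra.IsSeparable k E] [IsPurelyInseparable k M] :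
    IsField (E ⊗[k] M) := by
  have : IsReduced (M ⊗[k] E) := isReduced_tensorProduct_of_isSeparable
  have : IsReduced (E ⊗[k] M) :=
    isReduced_of_injective (Algebra.TensorProduct.comm k E M) (AlgEquiv.injective _)
  have hunit (z : E ⊗[k] M) (hz : z ≠ 0) : IsUnit z := by
    obtain ⟨n, hn, e, he⟩ := IsPurelyInseparable.exists_pow_mem_range_tensorProduct z
    have he0 : e ≠ 0 := fun h => hz (pow_eq_zero_iff hn.ne' |>.mp (by rw [← he, h, map_zero]))
    exact (isUnit_pow_iff hn.ne').mp (he ▸ (Ne.isUnit he0).map _)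
  exact ⟨exists_pair_ne _, mul_comm, fun hz => (hunit _ hz).exists_right_inv⟩

end TensorProductField

section Normality

theorem isReduced_of_smooth {W Z : Scheme.{u}} [IsIntegral Z] (g : W ⟶ Z) [Smooth g] :
    IsReduced W := by
  have (x : W) : _root_.IsReduced (W.presheaf.stalk x) := by
    obtain ⟨U, _, V, hV, hx, e, hs⟩ := Smooth.exists_isStandardSmooth g x
    have : Nonempty U := ⟨⟨g x, e hx⟩⟩
    have := isReduced_of_isStandardSmooth hs
    let : Algebra Γ(W, V) (W.presheaf.stalk x) :=
      TopCat.Presheaf.algebra_section_stalk W.presheaf (⟨x, hx⟩ : V)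
    have : IsLocalization.AtPrime (W.presheaf.stalk x) (hV.primeIdealOf ⟨x, hx⟩).asIdeal :=
      hV.isLocalization_stalk ⟨x, hx⟩
    exact isReduced_localizationPreserves (hV.primeIdealOf ⟨x, hx⟩).asIdeal.primeCompl _ ‹_›
  exact isReduced_of_isReduced_stalk W

variable {Z : Scheme.{u}} [IsIntegral Z]

theorem isNormal_of_affine
    (h : ∀ x : Z, ∃ U : Z.Opens, IsAffineOpen U ∧ x ∈ U ∧ IsIntegrallyClosed Γ(Z, U)) :
    IsNormal Z := by
  intro x
  obtain ⟨U, hU, hx, hc⟩ := h x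
  have : Nonempty U := ⟨⟨x, hx⟩⟩
  let : Algebra Γ(Z, U) (Z.presheaf.stalk x) :=
    TopCat.Presheaf.algebra_section_stalk Z.presheaf (⟨x, hx⟩ : U)
  have : IsLocalization.AtPrime (Z.presheaf.stalk x) (hU.primeIdealOf ⟨x, hx⟩).asIdeal :=
    hU.isLocalization_stalk ⟨x, hx⟩
  exact ⟨inferInstance, isIntegrallyClosed_of_isLocalization _
    (hU.primeIdealOf ⟨x, hx⟩).asIdeal.primeCompl (Ideal.primeCompl_le_nonZeroDivisors _)⟩

theorem IsNormal.isIntegrallyClosed (h : IsNormal Z) {U : Z.Opens} (hU : IsAffineOpen U)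
    [Nonempty U] : IsIntegrallyClosed Γ(Z, U) := by
  refine IsIntegrallyClosed.of_localization_maximal fun P _ _ => ?_
  let y : PrimeSpectrum Γ(Z, U) := ⟨P, inferInstance⟩
  have hy : hU.fromSpec y ∈ U := hU.range_fromSpec.subset (Set.mem_range_self y)
  let : Algebra Γ(Z, U) (Z.presheaf.stalk (hU.fromSpec y)) :=
    TopCat.Presheaf.algebra_section_stalk Z.presheaf ⟨hU.fromSpec y, hy⟩
  have : IsLocalization.AtPrime (Z.presheaf.stalk (hU.fromSpec y)) P :=
    hU.isLocalization_stalk' y hy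
  have := (h (hU.fromSpec y)).2
  exact .of_equiv (IsLocalization.algEquiv P.primeCompl (Z.presheaf.stalk (hU.fromSpec y))
    (Localization.AtPrime P)).toRingEquiv

theorem isNormal_of_smooth {W : Scheme.{u}} [IsIntegral W] (hZ : IsNormal Z) (g : W ⟶ Z)
    [Smooth g] : IsNormal W := by
  refine isNormal_of_affine fun x => ?_
  obtain ⟨U, hU, V, hV, hx, e, hs⟩ := Smooth.exists_isStandardSmooth g x
  have : Nonempty U := ⟨⟨g x, e hx⟩⟩
  have : Nonempty V := ⟨⟨x, hx⟩⟩
  have := hZ.isIntegrallyClosed hU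
  exact ⟨V, hV, hx, isIntegrallyClosed_of_isStandardSmooth hs⟩

theorem isNormal_Spec (A : CommRingCat.{u}) [IsDomain A] [IsIntegrallyClosed A] :
    IsNormal (Spec A) :=
  isNormal_of_affine fun _ => ⟨⊤, isAffineOpen_top _, trivial,
    .of_equiv (Scheme.ΓSpecIso A).commRingCatIsoToRingEquiv.symm⟩

end Normality

section FunctionField

theorem map_genericPoint {V W : Scheme.{u}} [IsIntegral V] [IsIntegral W] (f : V ⟶ W)
    [IsDominant f] : f (genericPoint V) = genericPoint W := by
  refine IsGenericPoint.eq ?_ (genericPoint_spec W)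
  have h := (genericPoint_spec V).image f.continuous
  rwa [Set.image_univ, f.denseRange.closure_range] at h

instance isDominant_of_flat {V W : Scheme.{u}} [Nonempty V] [IsIntegral W] (f : V ⟶ W) [Flat f] :
    IsDominant f := by
  obtain ⟨x⟩ := ‹Nonempty V›
  obtain ⟨y, -, hy⟩ := Flat.generalizingMap f
    (show genericPoint W ⤳ f x from (genericPoint_spec W).specializes trivial)
  refine ⟨(dense_iff_closure_eq.mpr (genericPoint_spec W).def : Dense {genericPoint W}).mono ?_⟩
  exact Set.singleton_subset_iff.mpr ⟨y, hy⟩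

instance flat_fromSpecStalk (Z : Scheme.{u}) (x : Z) : Flat (Z.fromSpecStalk x) := by
  obtain ⟨_, ⟨U, hU, rfl⟩, hxU, -⟩ :=
    Z.isBasis_affineOpens.exists_subset_of_mem_open (Set.mem_univ x) isOpen_univ
  rw [← hU.fromSpecStalk_eq_fromSpecStalk hxU]
  let : Algebra Γ(Z, U) (Z.presheaf.stalk x) :=
    TopCat.Presheaf.algebra_section_stalk Z.presheaf (⟨x, hxU⟩ : U)
  have : IsLocalization.AtPrime (Z.presheaf.stalk x) (hU.primeIdealOf ⟨x, hxU⟩).asIdeal :=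
    hU.isLocalization_stalk ⟨x, hxU⟩
  have : Flat (Spec.map (Z.presheaf.germ U x hxU)) := Flat.SpecMap_iff.mpr <|
    IsLocalization.flat (Z.presheaf.stalk x) (hU.primeIdealOf ⟨x, hxU⟩).asIdeal.primeCompl
  have := hU.isOpenImmersion_fromSpec
  exact inferInstanceAs (Flat (Spec.map (Z.presheaf.germ U x hxU) ≫ hU.fromSpec))

variable {V W : Scheme.{u}} [IsIntegral V] [IsIntegral W]

/-- The inclusion `K(W) ⟶ K(V)` of function fields induced by a dominant morphism `V ⟶ W` of
integral schemes. -/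
noncomputable def functionFieldMap (f : V ⟶ W) [IsDominant f] :
    W.functionField ⟶ V.functionField :=
  W.presheaf.stalkSpecializes (specializes_of_eq (map_genericPoint f)) ≫ f.stalkMap (genericPoint V)

theorem SpecMap_functionFieldMap_genericInclusion (f : V ⟶ W) [IsDominant f] :
    Spec.map (functionFieldMap f) ≫ genericInclusion W = genericInclusion V ≫ f := by
  rw [functionFieldMap, Spec.map_comp, Category.assoc,
    Scheme.SpecMap_stalkSpecializes_fromSpecStalk, Scheme.SpecMap_stalkMap_fromSpecStalk]

theorem specMap_toFunctionField {k : Type u} [CommRing k] (s : V ⟶ Spec (CommRingCat.of k)) :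
    Spec.map (CommRingCat.ofHom (toFunctionField s)) = genericInclusion V ≫ s := by
  have h : s = V.toSpecΓ ≫ Spec.map ((Scheme.ΓSpecIso (CommRingCat.of k)).inv ≫ s.appTop) := by
    rw [Spec.map_comp, ← Scheme.toSpecΓ_naturality_assoc]
    simp
  conv_rhs => rw [h, Scheme.fromSpecStalk_toSpecΓ_assoc, ← Spec.map_comp]
  rw [Category.assoc]
  rfl

theorem eq_of_specMap_ofHom_eq {A B : Type u} [CommRing A] [CommRing B] {i j : A →+* B}
    (h : Spec.map (CommRingCat.ofHom i) = Spec.map (CommRingCat.ofHom j)) : i = j :=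
  congrArg CommRingCat.Hom.hom (Spec.map_injective h)

theorem functionFieldMap_comp_toFunctionField {k : Type u} [CommRing k] (f : V ⟶ W)
    [IsDominant f] (s : W ⟶ Spec (CommRingCat.of k)) :
    (functionFieldMap f).hom.comp (toFunctionField s) = toFunctionField (f ≫ s) := by
  refine eq_of_specMap_ofHom_eq ?_
  rw [CommRingCat.ofHom_comp, CommRingCat.ofHom_hom, Spec.map_comp, specMap_toFunctionField s,
    specMap_toFunctionField (f ≫ s), ← Category.assoc, SpecMap_functionFieldMap_genericInclusion,
    Category.assoc]

theorem toFunctionField_comp_specMap {k l : Type u} [CommRing k] [CommRing l]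
    (t : V ⟶ Spec (CommRingCat.of l)) (i : k →+* l) :
    toFunctionField (t ≫ Spec.map (CommRingCat.ofHom i)) = (toFunctionField t).comp i := by
  refine eq_of_specMap_ofHom_eq ?_
  calc _ = Spec.map (CommRingCat.ofHom (toFunctionField t)) ≫ Spec.map (CommRingCat.ofHom i) := by
        rw [specMap_toFunctionField, specMap_toFunctionField, Category.assoc]
    _ = _ := (Spec.map_comp _ _).symm

instance isIso_functionFieldMap (j : V ⟶ W) [Flat j] [Mono j] :
    IsIso (Spec.map (functionFieldMap j)) := by
  have : Mono (Spec.map (functionFieldMap j) ≫ genericInclusion W) := by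
    rw [SpecMap_functionFieldMap_genericInclusion]
    infer_instance
  have := mono_of_mono (Spec.map (functionFieldMap j)) (genericInclusion W)
  let : Algebra W.functionField V.functionField := (functionFieldMap j).hom.toAlgebra
  have : Flat (Spec.map (functionFieldMap j)) :=
    Flat.SpecMap_iff.mpr (inferInstanceAs (Module.Flat W.functionField V.functionField))
  have : Surjective (Spec.map (functionFieldMap j)) :=
    ⟨fun x => ⟨genericPoint _, Subsingleton.elim (α := PrimeSpectrum W.functionField) _ _⟩⟩
  exact Flat.isIso_of_surjective_of_mono _

end FunctionField

section IntegralLifting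

instance isMultiplicative_llp_isIntegralHom :
    (MorphismProperty.llp @IsIntegralHom.{u}).IsMultiplicative :=
  MorphismProperty.llp_isMultiplicative _

variable {T V W : Scheme.{u}}

theorem llp_toNormalization (f : V ⟶ W) [QuasiCompact f] [QuasiSeparated f] :
    MorphismProperty.llp @IsIntegralHom f.toNormalization := by
  refine fun S₁ S₂ b hb => ⟨fun {u v} sq => ⟨⟨?_⟩⟩⟩
  have := hb
  let q : V ⟶ pullback v b := pullback.lift f.toNormalization u sq.w.symm
  have hq : q ≫ pullback.fst v b = f.toNormalization := pullback.lift_fst ..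
  let d := f.normalizationDesc q (pullback.fst v b ≫ f.fromNormalization) (by
    rw [reassoc_of% hq, Scheme.Hom.toNormalization_fromNormalization])
  have hfd : f.toNormalization ≫ d = q := Scheme.Hom.toNormalization_normalizationDesc ..
  have hd : d ≫ pullback.fst v b = 𝟙 _ := by
    refine Scheme.Hom.normalization.hom_ext f _ _ f.fromNormalization ?_ ?_ (Category.id_comp _)
    · rw [reassoc_of% hfd, hq, Category.comp_id]
    · rw [Category.assoc]
      exact Scheme.Hom.normalizationDesc_comp ..
  exact
    { l := d ≫ pullback.snd v b
      fac_left := by rw [reassoc_of% hfd, pullback.lift_snd]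
      fac_right := by rw [Category.assoc, ← pullback.condition, reassoc_of% hd] }

theorem llp_of_isIso_fromNormalization (f : V ⟶ W) [QuasiCompact f] [QuasiSeparated f]
    [IsIso f.fromNormalization] : MorphismProperty.llp @IsIntegralHom f := by
  rw [← f.toNormalization_fromNormalization]
  exact MorphismProperty.comp_mem _ _ _ (llp_toNormalization f) (MorphismProperty.llp_of_isIso _ _)

/-- Two lifts agree because the diagonal of an integral morphism is again integral. -/
theorem hom_ext_of_llp {f : V ⟶ W} (hf : MorphismProperty.llp @IsIntegralHom f)
    {S : Scheme.{u}} {g₁ g₂ : W ⟶ T} (b : T ⟶ S) [IsIntegralHom b]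
    (h : f ≫ g₁ = f ≫ g₂) (hb : g₁ ≫ b = g₂ ≫ b) : g₁ = g₂ := by
  have := hf (pullback.diagonal b) inferInstance
  have sq : CommSq (f ≫ g₁) f (pullback.diagonal b) (pullback.lift g₁ g₂ hb) := by
    refine ⟨pullback.hom_ext ?_ ?_⟩
    · simp only [Category.assoc, pullback.lift_fst, pullback.diagonal_fst, Category.comp_id]
    · simp only [Category.assoc, pullback.lift_snd, pullback.diagonal_snd, Category.comp_id, h]
  have h₁ := congr($sq.fac_right ≫ pullback.fst b b)
  have h₂ := congr($sq.fac_right ≫ pullback.snd b b)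
  simp only [Category.assoc, pullback.diagonal_fst, pullback.diagonal_snd, Category.comp_id,
    pullback.lift_fst, pullback.lift_snd] at h₁ h₂
  exact h₁.symm.trans h₂

theorem exists_iso_of_llp_of_isIntegralHom {W' S : Scheme.{u}} {f : V ⟶ W} {f' : V ⟶ W'}
    {b : W ⟶ S} {b' : W' ⟶ S} (hf : MorphismProperty.llp @IsIntegralHom f)
    (hf' : MorphismProperty.llp @IsIntegralHom f') [IsIntegralHom b] [IsIntegralHom b']
    (h : f ≫ b = f' ≫ b') :
    ∃ e : W ≅ W', e.hom ≫ b' = b := by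
  have := hf b' inferInstance
  have := hf' b inferInstance
  have sq : CommSq f' f b' b := ⟨h.symm⟩
  have sq' : CommSq f f' b b' := ⟨h⟩
  refine ⟨⟨sq.lift, sq'.lift, ?_, ?_⟩, sq.fac_right⟩
  · exact hom_ext_of_llp hf b (by simp) (by simp)
  · exact hom_ext_of_llp hf' b' (by simp) (by simp)

end IntegralLifting

section Normalization

theorem bijective_algebraMap_integralClosure_iff {A S : Type*} [CommRing A] [CommRing S]
    [Algebra A S] :
    Function.Bijective (algebraMap A (integralClosure A S)) ↔ IsIntegrallyClosedIn A S := by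
  rw [isIntegrallyClosedIn_iff]
  refine and_congr ⟨fun h a b hab => h (Subtype.ext hab), fun h a b hab => h congr(($hab : S))⟩
    ⟨fun h x hx => ?_, fun h x => ?_⟩
  · obtain ⟨a, ha⟩ := h ⟨x, hx⟩
    exact ⟨a, congr(($ha : S))⟩
  · obtain ⟨a, ha⟩ := h x.2
    exact ⟨a, Subtype.ext ha⟩

theorem irreducibleSpace_of_isEmbedding {V W : Type*} [TopologicalSpace V] [TopologicalSpace W]
    {j : V → W} (hj : Topology.IsEmbedding j) {v : V} (hv : IsGenericPoint (j v) ⊤) :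
    IrreducibleSpace V := by
  have hmem {O : Set V} (hO : IsOpen O) (hne : O.Nonempty) : v ∈ O := by
    obtain ⟨O', hO', rfl⟩ := hj.isOpen_iff.mp hO
    obtain ⟨x, hx⟩ := hne
    exact (hv.mem_open_set_iff hO').mpr ⟨j x, trivial, hx⟩
  exact
    { isPreirreducible_univ := fun O₁ O₂ h₁ h₂ ⟨x, _, hx⟩ ⟨y, _, hy⟩ =>
        ⟨v, trivial, hmem h₁ ⟨x, hx⟩, hmem h₂ ⟨y, hy⟩⟩
      toNonempty := ⟨v⟩ }

variable {Z : Scheme.{u}} [IsIntegral Z]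

theorem isIso_fromNormalization_app_iff {U : Z.Opens} (hU : IsAffineOpen U) [hne : Nonempty U] :
    IsIso ((genericInclusion Z).fromNormalization.app U) ↔ IsIntegrallyClosed Γ(Z, U) := by
  let : Algebra Γ(Z, U) Γ(Spec Z.functionField, genericInclusion Z ⁻¹ᵁ U) :=
    ((genericInclusion Z).app U).hom.toAlgebra
  have hη : genericPoint Z ∈ U :=
    ((genericPoint_spec Z).mem_open_set_iff U.isOpen).mpr (by simpa using hne)
  have htop : genericInclusion Z ⁻¹ᵁ U = ⊤ := by
    refine top_le_iff.mp fun y _ => ?_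
    rw [show y = IsLocalRing.closedPoint Z.functionField from
      Subsingleton.elim (α := PrimeSpectrum _) _ _]
    change genericInclusion Z _ ∈ U
    rwa [Scheme.fromSpecStalk_closedPoint]
  have : IsFractionRing Γ(Z, U) Z.functionField :=
    functionField_isFractionRing_of_isAffineOpen _ U hU
  let i : Z.functionField ≅ Γ(Spec Z.functionField, genericInclusion Z ⁻¹ᵁ U) :=
    (Scheme.ΓSpecIso Z.functionField).symm ≪≫
      (Spec Z.functionField).presheaf.mapIso (eqToIso htop).op
  let e : Z.functionField ≃ₐ[Γ(Z, U)] Γ(Spec Z.functionField, genericInclusion Z ⁻¹ᵁ U) :=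
    { i.commRingCatIsoToRingEquiv with
      commutes' := fun a => by
        change (Z.presheaf.germ U (genericPoint Z) hη ≫ i.hom) a = (genericInclusion Z).app U a
        rw [Scheme.fromSpecStalk_app hη]
        rfl }
  rw [isIntegrallyClosed_iff_isIntegrallyClosedIn Z.functionField, e.isIntegrallyClosedIn,
    ← bijective_algebraMap_integralClosure_iff, Scheme.Hom.fromNormalization_app _ hU,
    isIso_comp_right_iff, ConcreteCategory.isIso_iff_bijective]
  rfl

theorem isIso_fromNormalization_iff :
    IsIso (genericInclusion Z).fromNormalization ↔ IsNormal Z := by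
  have hbasis (x : Z) : ∃ U : Z.Opens, IsAffineOpen U ∧ x ∈ U := by
    obtain ⟨_, ⟨U, hU, rfl⟩, hxU, -⟩ :=
      Z.isBasis_affineOpens.exists_subset_of_mem_open (Set.mem_univ x) isOpen_univ
    exact ⟨U, hU, hxU⟩
  constructor
  · refine fun h => isNormal_of_affine fun x => ?_
    obtain ⟨U, hU, hxU⟩ := hbasis x
    have : Nonempty U := ⟨⟨x, hxU⟩⟩
    exact ⟨U, hU, hxU, (isIso_fromNormalization_app_iff hU).mp inferInstance⟩
  · refine fun h => IsZariskiLocalAtTarget.of_forall_exists_morphismRestrict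
      (P := .isomorphisms _) fun x => ?_
    obtain ⟨U, hU, hxU⟩ := hbasis x
    have : Nonempty U := ⟨⟨x, hxU⟩⟩
    exact ⟨U, hxU, (isIso_morphismRestrict_iff_isIso_app _ hU).mpr
      ((isIso_fromNormalization_app_iff hU).mpr (h.isIntegrallyClosed hU))⟩

theorem IsNormal.llp_genericInclusion (h : IsNormal Z) :
    MorphismProperty.llp @IsIntegralHom (genericInclusion Z) :=
  have := isIso_fromNormalization_iff.mpr h
  llp_of_isIso_fromNormalization (genericInclusion Z)

variable {Z' : Scheme.{u}} {ν : Z' ⟶ Z}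

/-- The normalisation is the factorisation of the generic point for the orthogonal factorisation
system whose right class consists of the integral morphisms. -/
theorem isNormalization_iff :
    IsNormalization ν ↔ IsIntegralHom ν ∧ ∃ η : Spec Z.functionField ⟶ Z',
      MorphismProperty.llp @IsIntegralHom η ∧ η ≫ ν = genericInclusion Z := by
  constructor
  · rintro ⟨e, rfl⟩
    refine ⟨inferInstance, (genericInclusion Z).toNormalization ≫ e.inv, ?_, by simp⟩
    exact MorphismProperty.comp_mem _ _ _ (llp_toNormalization _)
      (MorphismProperty.llp_of_isIso _ _)
  · rintro ⟨_, η, hη, hην⟩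
    exact exists_iso_of_llp_of_isIntegralHom hη (llp_toNormalization (genericInclusion Z))
      (by rw [hην, Scheme.Hom.toNormalization_fromNormalization])

theorem IsNormalization.isIso_iff (h : IsNormalization ν) : IsIso ν ↔ IsNormal Z := by
  obtain ⟨e, rfl⟩ := h
  rw [isIso_comp_left_iff, isIso_fromNormalization_iff]

theorem IsNormalization.isIntegral (h : IsNormalization ν) : IsIntegral Z' := by
  obtain ⟨e, -⟩ := h
  have : Nonempty Z' := ⟨e.inv (genericPoint _)⟩
  exact isIntegral_of_isOpenImmersion e.hom

variable {W : Scheme.{u}} [IsIntegral W]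

theorem isIntegral_pullback_genericInclusion (g : W ⟶ Z) [Smooth g] :
    IsIntegral (pullback (genericInclusion Z) g) := by
  have : IsReduced (pullback (genericInclusion Z) g) :=
    isReduced_of_smooth (pullback.fst (genericInclusion Z) g)
  let q : Spec W.functionField ⟶ pullback (genericInclusion Z) g :=
    pullback.lift _ (genericInclusion W) (SpecMap_functionFieldMap_genericInclusion g)
  have hq : pullback.snd (genericInclusion Z) g (q (IsLocalRing.closedPoint W.functionField)) =
      genericPoint W := by
    refine (Scheme.Hom.comp_apply q _ _).symm.trans ?_
    rw [pullback.lift_snd, Scheme.fromSpecStalk_closedPoint]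
  have := irreducibleSpace_of_isEmbedding (pullback.snd (genericInclusion Z) g).isEmbedding
    (hq ▸ genericPoint_spec W)
  exact isIntegral_of_irreducibleSpace_of_isReduced _

theorem exists_llp_pullback_genericInclusion (g : W ⟶ Z) [Smooth g] :
    ∃ η : Spec W.functionField ⟶ pullback (genericInclusion Z) g,
      MorphismProperty.llp @IsIntegralHom η ∧
        η ≫ pullback.snd (genericInclusion Z) g = genericInclusion W := by
  have := isIntegral_pullback_genericInclusion g
  have hV : IsNormal (pullback (genericInclusion Z) g) :=
    isNormal_of_smooth (isNormal_Spec Z.functionField) (pullback.fst (genericInclusion Z) g)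
  refine ⟨inv (Spec.map (functionFieldMap (pullback.snd (genericInclusion Z) g))) ≫
    genericInclusion _, ?_, ?_⟩
  · exact MorphismProperty.comp_mem _ _ _ (MorphismProperty.llp_of_isIso _ _)
      hV.llp_genericInclusion
  · rw [Category.assoc, IsIso.inv_comp_eq, SpecMap_functionFieldMap_genericInclusion]

/-- Relative normalisation commutes with smooth base change, and the generic fibre of `g` is normal,
so that its own generic point lifts against integral morphisms. -/
theorem IsNormalization.of_isPullback {W' : Scheme.{u}} {g : W ⟶ Z} [Smooth g] {ν' : W' ⟶ W}
    {g' : W' ⟶ Z'} (h : IsPullback g' ν' ν g) (hν : IsNormalization ν) : IsNormalization ν' := by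
  have : IsIntegralHom ν := (isNormalization_iff.mp hν).1
  have hν' : IsIntegralHom ν' :=
    MorphismProperty.of_isPullback (P := @IsIntegralHom) h inferInstance
  obtain ⟨e, he⟩ := hν
  obtain ⟨η, hη, hηj⟩ := exists_llp_pullback_genericInclusion g
  have hp : IsPullback (g' ≫ e.hom) ν' (genericInclusion Z).fromNormalization g :=
    h.of_iso (Iso.refl _) e (Iso.refl _) (Iso.refl _) (by simp) (by simp) (by simp [he]) (by simp)
  let j := pullback.snd (genericInclusion Z) g
  let θ : pullback (genericInclusion Z) g ⟶ W' :=
    j.toNormalization ≫ (genericInclusion Z).normalizationPullback g ≫ hp.isoPullback.inv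
  have hθ : MorphismProperty.llp @IsIntegralHom θ :=
    MorphismProperty.comp_mem _ _ _
      (llp_toNormalization j) (MorphismProperty.llp_of_isIso _ _)
  refine isNormalization_iff.mpr ⟨hν', η ≫ θ,
    MorphismProperty.comp_mem _ _ _ hη hθ, ?_⟩
  simp only [θ, Category.assoc, IsPullback.isoPullback_inv_snd]
  rw [← hηj]
  congr 1
  rw [Scheme.Hom.normalizationPullback_snd]
  exact j.toNormalization_fromNormalization

end Normalization

section PurelyInseparable

theorem universallyInjective_specMap (k l : Type u) [Field k] [Field l] [Algebra k l]
    [IsPurelyInseparable k l] : UniversallyInjective (specMap k l) := by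
  refine ((tfae_universallyInjective (specMap k l)).out 1 0).mp ?_
  intro K _ g₁ g₂ hg
  obtain ⟨α, rfl⟩ := Spec.map_surjective g₁
  obtain ⟨β, rfl⟩ := Spec.map_surjective g₂
  have hαβ : α.hom.comp (algebraMap k l) = β.hom.comp (algebraMap k l) :=
    eq_of_specMap_ofHom_eq (by simpa using hg)
  congr 1
  exact CommRingCat.hom_ext (IsPurelyInseparable.injective_comp_algebraMap k l K hαβ)

theorem isPurelyInseparable_functionFieldMap {V W : Scheme.{u}} [IsIntegral V] [IsIntegral W]
    (f : V ⟶ W) [IsDominant f] [UniversallyInjective f] :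
    (functionFieldMap f).hom.IsPurelyInseparable := by
  let : Algebra W.functionField V.functionField := (functionFieldMap f).hom.toAlgebra
  let L := AlgebraicClosure V.functionField
  have : Nonempty (V.functionField →+* L) := ⟨algebraMap _ _⟩
  refine IsPurelyInseparable.of_injective_comp_algebraMap (L := L) _ _ fun α β hαβ => ?_
  refine eq_of_specMap_ofHom_eq ((cancel_mono (genericInclusion V)).mp ?_)
  have hinj := ((tfae_universallyInjective f).out 0 1).mp ‹_›
  refine hinj L ?_
  have hαβ' : functionFieldMap f ≫ CommRingCat.ofHom α = functionFieldMap f ≫ CommRingCat.ofHom β :=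
    CommRingCat.hom_ext hαβ
  simp only [Category.assoc, ← SpecMap_functionFieldMap_genericInclusion, ← Spec.map_comp_assoc]
  exact congrArg (fun γ => Spec.map γ ≫ genericInclusion W) hαβ'

theorem isIntegralHom_specMap (k l : Type u) [CommRing k] [CommRing l] [Algebra k l]
    [Algebra.IsIntegral k l] : IsIntegralHom (specMap k l) :=
  IsIntegralHom.SpecMap_iff.mpr fun x => Algebra.IsIntegral.isIntegral x

theorem isHomeomorph_of_isIntegralHom {W X : Scheme.{u}} (a : W ⟶ X) [IsIntegralHom a]
    [UniversallyInjective a] [Surjective a] : IsHomeomorph a :=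
  isHomeomorph_iff_continuous_isClosedMap_bijective.mpr
    ⟨a.continuous, a.isClosedMap, a.injective, a.surjective⟩

theorem isIntegral_of_isPullback_specMap {k l : Type u} [Field k] [Field l] [Algebra k l]
    [IsPurelyInseparable k l] {W X : Scheme.{u}} [IsIntegral X] [IsReduced W] {a : W ⟶ X}
    {b : W ⟶ Spec (CommRingCat.of l)} {s : X ⟶ Spec (CommRingCat.of k)}
    (hW : IsPullback a b s (specMap k l)) : IsIntegral W := by
  have := universallyInjective_specMap k l
  have := isIntegralHom_specMap k l
  have : Surjective (specMap k l) :=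
    ⟨fun x => ⟨IsLocalRing.closedPoint l, Subsingleton.elim (α := PrimeSpectrum k) _ _⟩⟩
  have : UniversallyInjective a :=
    MorphismProperty.of_isPullback (P := @UniversallyInjective) hW.flip inferInstance
  have : IsIntegralHom a :=
    MorphismProperty.of_isPullback (P := @IsIntegralHom) hW.flip inferInstance
  have : Surjective a :=
    MorphismProperty.of_isPullback (P := @Surjective) hW.flip inferInstance
  let e : X ≃ₜ W := (isHomeomorph_of_isIntegralHom a).homeomorph.symm
  have : IrreducibleSpace W := e.surjective.irreducibleSpace e.continuous
  exact isIntegral_of_irreducibleSpace_of_isReduced W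

end PurelyInseparable

section AlgebraicClosure

section

variable {R K : Type u} [CommRing R]

theorem isIntegral_closureIn [CommRing K] (g : R →+* K) : Algebra.IsIntegral R (closureIn g) := by
  refine ⟨fun x => ?_⟩
  let : Algebra R K := g.toAlgebra
  let φ : closureIn g →ₐ[R] K := { (closureIn g).subtype with commutes' := fun _ => rfl }
  exact (isIntegral_algHom_iff φ Subtype.val_injective).mp ((mem_closureIn _ _).mp x.2)

theorem isField_closureIn [Field K] (g : R →+* K) (hR : IsField R) : IsField (closureIn g) :=
  have := isIntegral_closureIn g
  isField_of_isIntegral_of_isField' hR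

theorem closureIn_subtype_closureIn [CommRing K] (g : R →+* K) :
    closureIn (closureIn g).subtype = closureIn g := by
  let : Algebra R K := g.toAlgebra
  have := isIntegral_closureIn g
  have : IsScalarTower R (closureIn g) K := .of_algebraMap_eq fun _ => rfl
  ext x
  exact ⟨fun hx => isIntegral_trans (R := R) (A := closureIn g) x hx,
    fun hx => (closureIn g).subtype.isIntegralElem_map (x := ⟨x, hx⟩)⟩

theorem isIntegrallyClosedIn_of_closureIn_eq_range [CommRing K] [Algebra R K]
    (hinj : Function.Injective (algebraMap R K))
    (h : closureIn (algebraMap R K) = (algebraMap R K).range) : IsIntegrallyClosedIn R K := by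
  refine isIntegrallyClosedIn_iff.mpr ⟨hinj, fun {x} hx => ?_⟩
  have hx' : x ∈ closureIn (algebraMap R K) := by
    rw [mem_closureIn]
    exact hx
  rwa [h] at hx'

end

variable {k : Type u} [Field k] {X : Scheme.{u}} [IsIntegral X]

/-- The generic point of `X` lifts against the integral morphism `Spec K ⟶ Spec k`, where `K` is the
algebraic closure of `k` in `K(X)`. -/
theorem exists_structureMorphism (hX : IsNormal X) (s : X ⟶ Spec (CommRingCat.of k)) :
    ∃ t : X ⟶ Spec (CommRingCat.of (closureInFunctionField s)),
      toFunctionField t = (closureInFunctionField s).subtype ∧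
        t ≫ specMap k (closureInFunctionField s) = s := by
  let K := closureInFunctionField s
  have := isIntegral_closureIn (toFunctionField s)
  have hsq : CommSq (Spec.map (CommRingCat.ofHom K.subtype)) (genericInclusion X) (specMap k K) s :=
    ⟨by
      rw [← specMap_toFunctionField]
      exact (Spec.map_comp (CommRingCat.ofHom (algebraMap k K)) (CommRingCat.ofHom K.subtype)).symm⟩
  have := hX.llp_genericInclusion (specMap k K) (isIntegralHom_specMap k K)
  refine ⟨hsq.lift, eq_of_specMap_ofHom_eq ?_, hsq.fac_right⟩
  rw [specMap_toFunctionField, hsq.fac_left]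

end AlgebraicClosure

section InseparableClosure

theorem IsNormalization.exists_isDominant {Z Z' : Scheme.{u}} [IsIntegral Z] {ν : Z' ⟶ Z}
    (h : IsNormalization ν) :
    ∃ η : Spec Z.functionField ⟶ Z', IsDominant η ∧ η ≫ ν = genericInclusion Z := by
  obtain ⟨e, rfl⟩ := h
  exact ⟨(genericInclusion Z).toNormalization ≫ e.inv, inferInstance, by simp⟩

variable {p : ℕ} {k l k' : Type u} [Field k] [Field l] [Field k'] [Algebra k l] [Algebra l k']
  {X X' : Scheme.{u}} [IsIntegral X] [IsIntegral X'] {s : X ⟶ Spec (CommRingCat.of k)}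
  {φ : X' ⟶ X} {ν : X' ⟶ pullback s (specMap k l)} {ι : k' →+* X'.functionField}

theorem IsElementalExtension.isIntegral_top (h : IsElementalExtension p s φ ν ι) :
    Algebra.IsIntegral l k' := by
  let : Algebra l X'.functionField :=
    (toFunctionField (ν ≫ pullback.snd s (specMap k l))).toAlgebra
  let ι' : k' →ₐ[l] X'.functionField := { ι with commutes' := fun x => congr($h.comp_algebraMap x) }
  refine ⟨fun x => (isIntegral_algHom_iff ι' ι.injective).mp ?_⟩
  have hx : ι x ∈ ι.range := ⟨x, rfl⟩
  rwa [h.range_eq, mem_closureIn] at hx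

variable [Algebra k k'] [IsScalarTower k l k']

/-- The field `K(X ×ₖ l)` is purely inseparable over `K(X)`, and `k` is algebraically closed in the
latter. -/
theorem IsElementalExtension.isPurelyInseparable_top (h : IsElementalExtension p s φ ν ι) :
    IsPurelyInseparable k k' := by
  have := h.isIntegral_baseChange
  have := h.isPurelyInseparable
  have := h.isIntegral_top
  have : Algebra.IsIntegral k k' := .trans l
  let Z := pullback s (specMap k l)
  obtain ⟨η, hη, hην⟩ := h.isNormalization.exists_isDominant
  have : UniversallyInjective (pullback.fst s (specMap k l)) :=
    MorphismProperty.of_isPullback (P := @UniversallyInjective) (IsPullback.of_hasPullback _ _).flip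
      (universallyInjective_specMap k l)
  let f : Spec Z.functionField ⟶ X := genericInclusion Z ≫ pullback.fst s (specMap k l)
  have : UniversallyInjective f :=
    MorphismProperty.comp_mem @UniversallyInjective (genericInclusion Z) _ inferInstance ‹_›
  let K := (Spec Z.functionField).functionField
  let : Algebra k X.functionField := (toFunctionField s).toAlgebra
  let : Algebra X.functionField K := (functionFieldMap f).hom.toAlgebra
  let : Algebra k K := ((functionFieldMap f).hom.comp (toFunctionField s)).toAlgebra
  have : IsScalarTower k X.functionField K := .of_algebraMap_eq fun _ => rfl
  have : IsPurelyInseparable X.functionField K := isPurelyInseparable_functionFieldMap f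
  have : IsIntegrallyClosedIn k X.functionField :=
    isIntegrallyClosedIn_of_closureIn_eq_range (algebraMap k X.functionField).injective h.algClosed
  have hσ : ((functionFieldMap η).hom.comp ι).comp (algebraMap k k') =
      (functionFieldMap f).hom.comp (toFunctionField s) := by
    rw [IsScalarTower.algebraMap_eq k l k', RingHom.comp_assoc, ← RingHom.comp_assoc _ _ ι,
      h.comp_algebraMap, ← toFunctionField_comp_specMap, functionFieldMap_comp_toFunctionField,
      functionFieldMap_comp_toFunctionField, Category.assoc, reassoc_of% hην, Category.assoc,
      pullback.condition]
  let σ : k' →ₐ[k] K :=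
    { (functionFieldMap η).hom.comp ι with commutes' := fun x => congr($hσ x) }
  exact isPurelyInseparable_of_isIntegrallyClosedIn (F := X.functionField) σ

end InseparableClosure

section SeparableClosure

/-- The `k`-algebra structure on `Γ(X, U)` given by a structure morphism `X ⟶ Spec k`. -/
noncomputable def toSections {k : Type u} [CommRing k] {X : Scheme.{u}}
    (s : X ⟶ Spec (CommRingCat.of k)) (U : X.Opens) : CommRingCat.of k ⟶ Γ(X, U) :=
  (Scheme.ΓSpecIso (CommRingCat.of k)).inv ≫ s.appLE ⊤ U (show U ≤ s ⁻¹ᵁ ⊤ from le_top)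

theorem toSections_appLE {k : Type u} [CommRing k] {X Y : Scheme.{u}} (f : X ⟶ Y)
    (s : Y ⟶ Spec (CommRingCat.of k)) {U : Y.Opens} {V : X.Opens} (e : V ≤ f ⁻¹ᵁ U) :
    toSections s U ≫ f.appLE U V e = toSections (f ≫ s) V := by
  rw [toSections, toSections, Category.assoc, Scheme.Hom.appLE_comp_appLE]

theorem toSections_germ {k : Type u} [CommRing k] {X : Scheme.{u}} [IsIntegral X]
    (s : X ⟶ Spec (CommRingCat.of k)) {U : X.Opens} (hU : genericPoint X ∈ U) :
    toSections s U ≫ X.presheaf.germ U _ hU = CommRingCat.ofHom (toFunctionField s) := by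
  simp only [toSections, Scheme.Hom.appLE, Category.assoc, TopCat.Presheaf.germ_res]
  rfl

theorem isSeparable_closureInFunctionField {k : Type u} [Field k] {X Y : Scheme.{u}} [IsIntegral X]
    [IsIntegral Y] (hYn : IsNormal Y) (f : X ⟶ Y) [Smooth f] (s : Y ⟶ Spec (CommRingCat.of k))
    (hs : closureIn (toFunctionField s) = (toFunctionField s).range) :
    Algebra.IsSeparable k (closureInFunctionField (f ≫ s)) := by
  obtain ⟨U, hU, V, hV, hx, e, hsm⟩ := Smooth.exists_isStandardSmooth f (genericPoint X)
  have : Nonempty V := ⟨⟨_, hx⟩⟩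
  have hη : genericPoint Y ∈ U := map_genericPoint f ▸ e hx
  have : Nonempty U := ⟨⟨_, hη⟩⟩
  let : Algebra k Γ(Y, U) := (toSections s U).hom.toAlgebra
  let : Algebra Γ(Y, U) Γ(X, V) := (f.appLE U V e).hom.toAlgebra
  let : Algebra k Y.functionField := (toFunctionField s).toAlgebra
  let : Algebra k X.functionField := (toFunctionField (f ≫ s)).toAlgebra
  have : IsFractionRing Γ(X, V) X.functionField :=
    functionField_isFractionRing_of_isAffineOpen _ V hV
  have := hYn.isIntegrallyClosed hU
  have : IsIntegrallyClosedIn k Y.functionField :=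
    isIntegrallyClosedIn_of_closureIn_eq_range (algebraMap k Y.functionField).injective hs
  let germ : Γ(Y, U) →ₐ[k] Y.functionField :=
    { (Y.presheaf.germ U _ hη).hom with commutes' := fun x => congr($(toSections_germ s hη) x) }
  have : IsIntegrallyClosedIn k Γ(Y, U) := isIntegrallyClosedIn_of_injective (φ := germ)
    (germ_injective_of_isIntegral Y (genericPoint Y) hη)
  have hcomp : toSections s U ≫ f.appLE U V e ≫ X.presheaf.germ V _ hx =
      CommRingCat.ofHom (toFunctionField (f ≫ s)) := by
    rw [← Category.assoc, toSections_appLE, toSections_germ]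
  let incl : closureInFunctionField (f ≫ s) →ₐ[k] X.functionField :=
    { (closureInFunctionField (f ≫ s)).subtype with commutes' := fun _ => rfl }
  refine ⟨fun x => (isSeparable_map_iff incl Subtype.val_injective).mp ?_⟩
  exact isSeparable_of_isStandardSmooth (A := Γ(Y, U)) (B := Γ(X, V)) congr(($hcomp).hom) hsm
    ((mem_closureIn _ _).mp x.2)

end SeparableClosure

section Descent

/-- Isomorphisms descend along faithfully flat morphisms of finite presentation, so it suffices to
compare the normalisations. -/
theorem isNormal_of_smooth_of_surjective {W Z : Scheme.{u}} [IsIntegral W] [IsIntegral Z]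
    (hW : IsNormal W) (g : W ⟶ Z) [Smooth g] [Surjective g] : IsNormal Z := by
  let ν := (genericInclusion Z).fromNormalization
  have hν : IsNormalization ν := ⟨Iso.refl _, Category.id_comp _⟩
  have h := IsPullback.of_hasPullback ν g
  have : IsIso (pullback.snd ν g) := (IsNormalization.of_isPullback h hν).isIso_iff.mpr hW
  exact hν.isIso_iff.mp <| MorphismProperty.of_isPullback_of_descendsAlong
    (P := .isomorphisms Scheme) (Q := @Surjective ⊓ @Flat ⊓ @LocallyOfFinitePresentation) h.flip
    ⟨⟨inferInstance, inferInstance⟩, inferInstance⟩ this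

end Descent

section BaseChange

theorem rank_le_rank_of_isField_tensorProduct {k l k' E N : Type u} [Field k] [Field l] [Field k']
    [Algebra k l] [Algebra l k'] [Algebra k k'] [IsScalarTower k l k'] [CommRing E] [Algebra k E]
    [CommRing N] [Nontrivial N] [Algebra (E ⊗[k] l) N] (hF : IsField (E ⊗[k] k')) (σ : k' →+* N)
    (hσ : σ.comp (algebraMap l k') = (algebraMap (E ⊗[k] l) N).comp
      (Algebra.TensorProduct.includeRight : l →ₐ[k] E ⊗[k] l).toRingHom) :
    Module.rank l k' ≤ Module.rank (E ⊗[k] l) N := by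
  let : Algebra l (E ⊗[k] l) := Algebra.TensorProduct.rightAlgebra
  let : Algebra l N := ((algebraMap (E ⊗[k] l) N).comp (algebraMap l (E ⊗[k] l))).toAlgebra
  have : IsScalarTower l (E ⊗[k] l) N := .of_algebraMap_eq fun _ => rfl
  have : Nontrivial (E ⊗[k] l) := (algebraMap (E ⊗[k] l) N).domain_nontrivial
  let σ' : k' →ₐ[l] N := { σ with commutes' := fun x => congr($hσ x) }
  let e : E ⊗[k] l ≃ₐ[l] l ⊗[k] E :=
    { Algebra.TensorProduct.comm k E l with commutes' := fun _ => rfl }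
  let e' : (E ⊗[k] l) ⊗[l] k' ≃+* E ⊗[k] k' :=
    ((Algebra.TensorProduct.comm l (E ⊗[k] l) k').trans
      (Algebra.TensorProduct.congr .refl e)).toRingEquiv.trans
    ((Algebra.TensorProduct.cancelBaseChange k l l k' E).toRingEquiv.trans
      (Algebra.TensorProduct.comm k k' E).toRingEquiv)
  have hF' : IsField ((E ⊗[k] l) ⊗[l] k') := e'.toMulEquiv.isField hF
  let Φ : (E ⊗[k] l) ⊗[l] k' →ₐ[E ⊗[k] l] N :=
    Algebra.TensorProduct.lift (Algebra.ofId _ N) σ' fun _ _ => .all _ _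
  have hΦ : Function.Injective Φ := by
    have := (isSimpleRing_iff_isField _).mpr hF'
    exact Φ.toRingHom.injective
  have h := LinearMap.rank_le_of_injective Φ.toLinearMap hΦ
  rwa [Module.rank_baseChange, Cardinal.lift_id] at h

theorem rank_le_rank_closureInFunctionField {k l k' E : Type u} [Field k] [Field l] [Field k']
    [Algebra k l] [Algebra l k'] [Algebra k k'] [IsScalarTower k l k'] [Algebra.IsIntegral l k']
    [CommRing E] [Algebra k E] (hF : IsField (E ⊗[k] k')) {V W : Scheme.{u}} [IsIntegral V]
    [IsIntegral W] (q : V ⟶ W) [IsDominant q] {t : W ⟶ Spec (CommRingCat.of l)}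
    {t' : V ⟶ Spec (CommRingCat.of (E ⊗[k] l))}
    (ht : t' ≫ Spec.map (CommRingCat.ofHom
      (Algebra.TensorProduct.includeRight : l →ₐ[k] E ⊗[k] l).toRingHom) = q ≫ t)
    {ι : k' →+* W.functionField} (hι : ι.comp (algebraMap l k') = toFunctionField t) :
    Module.rank l k' ≤ Module.rank (E ⊗[k] l) (closureInFunctionField t') := by
  let σ : k' →+* V.functionField := (functionFieldMap q).hom.comp ι
  have hσ : σ.comp (algebraMap l k') = (toFunctionField t').comp
      (Algebra.TensorProduct.includeRight : l →ₐ[k] E ⊗[k] l).toRingHom := by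
    rw [RingHom.comp_assoc, hι, functionFieldMap_comp_toFunctionField, ← ht,
      toFunctionField_comp_specMap]
  have hmem (x : k') : σ x ∈ closureInFunctionField t' := by
    have hx : (σ.comp (algebraMap l k')).IsIntegralElem (σ x) := by
      obtain ⟨P, hP, hPx⟩ := Algebra.IsIntegral.isIntegral (R := l) x
      exact ⟨P, hP, by rw [← Polynomial.hom_eval₂, hPx, map_zero]⟩
    rw [hσ] at hx
    exact RingHom.IsIntegralElem.of_comp hx
  refine rank_le_rank_of_isField_tensorProduct hF (σ.codRestrict _ hmem) ?_
  ext x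
  exact congr($hσ x)

theorem isPullback_snd_includeRight {k l E : Type u} [CommRing k] [CommRing l] [CommRing E]
    [Algebra k l] [Algebra k E] {X : Scheme.{u}} (t : X ⟶ Spec (CommRingCat.of E)) :
    IsPullback (pullback.fst t (specMap E (E ⊗[k] l)))
      (pullback.snd t (specMap E (E ⊗[k] l)) ≫ Spec.map (CommRingCat.ofHom
        (Algebra.TensorProduct.includeRight : l →ₐ[k] E ⊗[k] l).toRingHom))
      (t ≫ specMap k E) (specMap k l) :=
  (IsPullback.of_hasPullback t (specMap E (E ⊗[k] l))).paste_vert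
    (isPullback_SpecMap_of_isPushout _ _ _ _ (CommRingCat.isPushout_tensorProduct k E l))

theorem exists_isPullback_pullback_fst {X Y Z W Y' S T : Scheme.{u}} {a : Z ⟶ Y} {b : Z ⟶ T}
    {s : Y ⟶ S} {m : T ⟶ S} {c : W ⟶ X} {d : W ⟶ T} {f : X ⟶ Y} (hZ : IsPullback a b s m)
    (hW : IsPullback c d (f ≫ s) m) {ψ : Y' ⟶ Y} {ν : Y' ⟶ Z} (hν : ν ≫ a = ψ) :
    ∃ (g : W ⟶ Z) (ν' : pullback ψ f ⟶ W), IsPullback g c a f ∧ ν' ≫ c = pullback.snd ψ f ∧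
      ν' ≫ d = pullback.fst ψ f ≫ ν ≫ b ∧ IsPullback (pullback.fst ψ f) ν' ν g := by
  let g : W ⟶ Z := hZ.lift (c ≫ f) d (by rw [Category.assoc, hW.w])
  have hga : g ≫ a = c ≫ f := hZ.lift_fst _ _ _
  have hgb : g ≫ b = d := hZ.lift_snd _ _ _
  have hg : IsPullback g c a f := by
    refine (IsPullback.of_bot (v₂₁ := b) (v₂₂ := s) (h₃₁ := m) ?_ hga.symm hZ).flip
    rwa [hgb]
  let ν' : pullback ψ f ⟶ W := hg.lift (pullback.fst ψ f ≫ ν) (pullback.snd ψ f)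
    (by rw [Category.assoc, hν, pullback.condition])
  have hc : ν' ≫ c = pullback.snd ψ f := hg.lift_snd _ _ _
  have hgν : ν' ≫ g = pullback.fst ψ f ≫ ν := hg.lift_fst _ _ _
  refine ⟨g, ν', hg, hc, ?_, ?_⟩
  · rw [← hgb, reassoc_of% hgν]
  · refine IsPullback.of_bot (v₂₁ := c) (v₂₂ := a) (h₃₁ := f) ?_ hgν.symm hg
    rw [hc, hν]
    exact .of_hasPullback _ _

theorem IsVariety.of_comp_specMap {k K : Type u} [CommRing k] [CommRing K] [Algebra k K]
    {X : Scheme.{u}} {t : X ⟶ Spec (CommRingCat.of K)} (h : IsVariety (t ≫ specMap k K)) :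
    IsVariety t := by
  have := h.isSeparated
  have := h.locallyOfFiniteType
  have := h.quasiCompact
  exact ⟨h.isIntegral, .of_comp t (specMap k K), locallyOfFiniteType_of_comp t (specMap k K),
    .of_comp t (specMap k K)⟩

theorem isPurelyInseparable_tensorProduct {p : ℕ} [Fact p.Prime] {k E M : Type*} [Field k]
    [CharP k p] [CommRing E] [Algebra k E] [Field M] [Algebra k M] (hE : IsField E)
    (hEM : IsField (E ⊗[k] M)) (hM : ∀ m : M, m ^ p ∈ (algebraMap k M).range) :
    IsPurelyInseparable E (E ⊗[k] M) := by
  let := hE.toField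
  let := hEM.toField
  have : CharP E p := charP_of_injective_algebraMap (algebraMap k E).injective p
  exact (isPurelyInseparable_iff_pow_mem E p).mpr fun x =>
    ⟨1, by simpa only [pow_one] using pow_mem_range_tensorProduct hM x⟩

theorem exists_isNormalization_pullback_fst {k l : Type u} [Field k] [Field l] [Algebra k l]
    [IsPurelyInseparable k l] {X Y Y' Z W : Scheme.{u}} [IsIntegral X] [IsIntegral Z] {f : X ⟶ Y}
    [Smooth f] {s : Y ⟶ Spec (CommRingCat.of k)} {a : Z ⟶ Y} {b : Z ⟶ Spec (CommRingCat.of l)}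
    {c : W ⟶ X} {d : W ⟶ Spec (CommRingCat.of l)} (hZ : IsPullback a b s (specMap k l))
    (hW : IsPullback c d (f ≫ s) (specMap k l)) {ψ : Y' ⟶ Y} {ν : Y' ⟶ Z} (hνψ : ν ≫ a = ψ)
    (hν : IsNormalization ν) :
    ∃ (g : W ⟶ Z) (ν' : pullback ψ f ⟶ W), Smooth g ∧ (Surjective f → Surjective g) ∧
      ν' ≫ c = pullback.snd ψ f ∧ ν' ≫ d = pullback.fst ψ f ≫ ν ≫ b ∧
      ∃ _ : IsIntegral W, IsNormalization ν' := by
  obtain ⟨g, ν', hg, hc, hd, hgν⟩ := exists_isPullback_pullback_fst hZ hW hνψ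
  have hgs : Smooth g := MorphismProperty.of_isPullback (P := @Smooth) hg.flip inferInstance
  have := isReduced_of_smooth g
  have hWint := isIntegral_of_isPullback_specMap hW
  exact ⟨g, ν', hgs, fun h => MorphismProperty.of_isPullback (P := @Surjective) hg.flip h, hc, hd,
    hWint, .of_isPullback hgν hν⟩

variable {p : ℕ} {k l k' E : Type u} [Field k] [Field l] [Algebra k l]
  [CommRing E] [Algebra k E] {X X' : Scheme.{u}} [IsIntegral X] [IsIntegral X']

theorem isElementalExtension_tensorProduct [CharP k p] (hp : p.Prime) (hE : IsField E)
    (hEl : IsField (E ⊗[k] l)) (hl : ∀ x : l, x ^ p ∈ (algebraMap k l).range)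
    {s : X ⟶ Spec (CommRingCat.of k)} (hs : IsVariety s) {t : X ⟶ Spec (CommRingCat.of E)}
    (hts : t ≫ specMap k E = s)
    (hcl : closureIn (toFunctionField t) = (toFunctionField t).range)
    [IsIntegral (pullback t (specMap E (E ⊗[k] l)))] {φ : X' ⟶ X}
    {ν : X' ⟶ pullback t (specMap E (E ⊗[k] l))} (hν : IsNormalization ν)
    (hφ : ν ≫ pullback.fst t (specMap E (E ⊗[k] l)) = φ) :
    IsElementalExtension p t φ ν
      (closureInFunctionField (ν ≫ pullback.snd t (specMap E (E ⊗[k] l)))).subtype where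
  isField_base := hE
  prime := hp
  charP := let := hE.toField; charP_of_injective_algebraMap (algebraMap k E).injective p
  isVariety := IsVariety.of_comp_specMap (hts ▸ hs)
  algClosed := hcl
  isField_int := hEl
  isField_top := isField_closureIn _ hEl
  isPurelyInseparable := have := Fact.mk hp; isPurelyInseparable_tensorProduct hE hEl hl
  pow_mem := have := Fact.mk hp; pow_mem_range_tensorProduct hl
  isIntegral_baseChange := ‹_›
  isNormalization := hν
  comp_fst := hφ
  comp_algebraMap := rfl
  range_eq := Subring.range_subtype _

theorem IsElementalExtension.isField_tensorProduct [Field k'] [Algebra l k'] [Algebra k k']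
    [IsScalarTower k l k'] {s : X ⟶ Spec (CommRingCat.of k)} {φ : X' ⟶ X}
    {ν : X' ⟶ pullback s (specMap k l)} {ι : k' →+* X'.functionField}
    (h : IsElementalExtension p s φ ν ι) [Algebra.IsSeparable k E] (hE : IsField E) :
    IsField (E ⊗[k] l) ∧ IsField (E ⊗[k] k') := by
  let := hE.toField
  have := h.isPurelyInseparable
  have := h.isPurelyInseparable_top
  exact ⟨Elemental.isField_tensorProduct, Elemental.isField_tensorProduct⟩

end BaseChange

end Elemental

open Elemental in
theorem mainTheorem7 (p : ℕ)
    {kY lY kY' : Type u} [Field kY] [Field lY] [Field kY']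
    [Algebra kY lY] [Algebra lY kY'] [Algebra kY kY'] [IsScalarTower kY lY kY']
    {X Y Y' : Scheme.{u}} [IsIntegral X] [IsIntegral Y] [IsIntegral Y']
    (sX : X ⟶ Spec (CommRingCat.of kY)) (sY : Y ⟶ Spec (CommRingCat.of kY))
    (hX : IsVariety sX) (hXn : IsNormal X) (hYn : IsNormal Y)
    (f : X ⟶ Y) [Smooth f] (hf : f ≫ sY = sX)
    (ψ : Y' ⟶ Y) (νY : Y' ⟶ pullback sY (specMap kY lY)) (ιY : kY' →+* Y'.functionField)
    (hY : IsElementalExtension p sY ψ νY ιY) :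
    let kX := closureInFunctionField sX
    let lX := kX ⊗[kY] lY
    -- (1)
    (IsField lX ∧ IsField (kX ⊗[kY] kY')) ∧
    -- the structure morphism of `X` over `kX`
    ∃ tX : X ⟶ Spec (CommRingCat.of kX),
      toFunctionField tX = kX.subtype ∧ tX ≫ specMap kY kX = sX ∧
      -- the induced morphism `X' = Y' ×_Y X ⟶ X ×_{kX} lX`
      ∃ νX : pullback ψ f ⟶ pullback tX (specMap kX lX),
        νX ≫ pullback.fst tX (specMap kX lX) = pullback.snd ψ f ∧
        νX ≫ pullback.snd tX (specMap kX lX) ≫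
            Spec.map (CommRingCat.ofHom
              (Algebra.TensorProduct.includeRight : lY →ₐ[kY] lX).toRingHom) =
          pullback.fst ψ f ≫ νY ≫ pullback.snd sY (specMap kY lY) ∧
        -- (2)
        ∃ (_ : IsIntegral (pullback ψ f)) (_ : IsIntegral (pullback tX (specMap kX lX))),
          let kX' := closureInFunctionField (νX ≫ pullback.snd tX (specMap kX lX))
          IsNormalization νX ∧
          -- (3)
          IsElementalExtension p tX (pullback.snd ψ f) νX kX'.subtype ∧
          -- (4)
          Module.rank kX lX = Module.rank kY lY ∧
          Module.rank lY kY' ≤ Module.rank lX kX' ∧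
          -- (5)
          (IsNormal (pullback sY (specMap kY lY)) → IsNormal (pullback tX (specMap kX lX))) ∧
          -- (6)
          (Surjective f → IsNormal (pullback tX (specMap kX lX)) →
            IsNormal (pullback sY (specMap kY lY))) := by
  subst hf
  intro kX lX
  have := hY.charP
  have := hY.isIntegral_baseChange
  have := hY.isPurelyInseparable
  have := hY.isIntegral_top
  have := isSeparable_closureInFunctionField hYn f sY hY.algClosed
  have hkX : IsField kX := isField_closureIn _ (Field.toIsField kY)
  obtain ⟨hlX, hkXkY'⟩ := hY.isField_tensorProduct hkX
  obtain ⟨tX, htX, htX'⟩ := exists_structureMorphism hXn (f ≫ sY)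
  have hclosed : closureIn (toFunctionField tX) = (toFunctionField tX).range := by
    rw [htX, closureIn_subtype_closureIn, Subring.range_subtype]
  obtain ⟨g, νX, hg, hgsurj, hνX, hνX', hWint, hνn⟩ :=
    exists_isNormalization_pullback_fst (IsPullback.of_hasPullback _ _)
      (htX' ▸ isPullback_snd_includeRight tX) hY.comp_fst hY.isNormalization
  have hX'int := hνn.isIntegral
  exact ⟨⟨hlX, hkXkY'⟩, tX, htX, htX', νX, hνX, hνX', hX'int, hWint, hνn,
    isElementalExtension_tensorProduct hY.prime hkX hlX hY.pow_mem hX htX' hclosed hνn hνX,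
    (Module.rank_baseChange ..).trans (Cardinal.lift_id _),
    rank_le_rank_closureInFunctionField hkXkY' (pullback.fst ψ f)
      ((Category.assoc _ _ _).trans hνX') hY.comp_algebraMap,
    fun h => isNormal_of_smooth h g,
    fun hsurj h => have := hgsurj hsurj; isNormal_of_smooth_of_surjective h g⟩
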